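/- An arena is a countable directed graph $(V,E)$ in which every vertex has an outgoing edge, with a partition of $V$ into vertices $V_E$ of Eve and $V_A$ of Adam. A play from $v_0$ is formed by letting the owner of the current vertex choose an outgoing edge at each step. A strategy of a player maps each finite history ending in one of the player's vertices to a successor of that vertex; Eve's strategy $\sigma$ is winning from $U\subseteq V$ for a set $\Omega$ of infinite plays if, for every $v_0\in U$ and every strategy of Adam, the resulting play is in $\Omega$. Eve's winning set is the set of vertices $v$ such that Eve has a winning strategy from $\{v\}$. A memory structure consists of a set $M$ of memory states, an initial state $m_0\in M$ and an update function $\mu:M\times E\to M$, applied to each edge taken; a strategy relies on it if its moves are a function of the current vertex and the current memory state, and it is memoryless if its moves are a function of the current vertex only. For $F\subseteq V$ and a play $\pi=\pi_0\pi_1\cdots$ let $\mathrm{dist}_k(\pi,F)=\inf\{k'-k : k'\ge k,\ \pi_{k'}\in F\}$, and for a colouring $c:V\to\{0,\dots,d\}$ let $\mathrm{dist}_k(\pi,c)=\inf\{k'-k : k'\ge k,\ c(\pi_{k'})\text{ is even},\ c(\pi_{k'})\le c(\pi_k)\}$, where $\inf\emptyset=\infty$. The finitary Büchi condition is $\{\pi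 : \limsup_k \mathrm{dist}_k(\pi,F)<\infty\}$ and the finitary parity condition is $\{\pi : \limsup_k \mathrm{dist}_k(\pi,c)<\infty\}$. **Theorem (Strategy complexity for finitary games).** For every arena the following hold. 1. For every $F\subseteq V$, Eve has a memoryless strategy that is winning from her whole winning set for the finitary Büchi condition of $F$. 2. For every $d\in\mathbb N$ and every $c:V\to\{0,\dots,d\}$, Eve has a strategy that is winning from her whole winning set for the finitary parity condition of $c$ and that relies on a memory structure with at most $\ell+1$ memory states, where $\ell$ is the number of odd colours in $\{0,\dots,d\}$. -/

import Mathlib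

namespace FinitaryGames

/-- An arena on the vertex set `V`: the edge relation of a graph without dead ends, and the set of
vertices controlled by Eve. The vertices outside `eve` are controlled by Adam. -/
structure Arena (V : Type*) where
  eve : Set V
  Edge : V → V → Prop
  no_dead_end : ∀ v, ∃ v', Edge v v'

/-- The vertices controlled by Adam. -/
def Arena.adam {V : Type*} (A : Arena V) : Set V := A.eveᶜ

/-- A strategy for the player who controls the vertices of `S`: given the past `w` of the play
and the current vertex `v ∈ S`, it picks a successor of `v`. The list `w` holds the vertices
visited strictly before `v`, the most recent one first. -/
structure Strategy {V : Type*} (A : Arena V) (S : Set V) where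
  move : List V → S → V
  legal : ∀ (w : List V) (v : S), A.Edge v (move w v)

/-- Strategies for Eve. -/
abbrev EveStrategy {V : Type*} (A : Arena V) := Strategy A A.eve

/-- Strategies for Adam. -/
abbrev AdamStrategy {V : Type*} (A : Arena V) := Strategy A A.adam

open Classical in
/-- The vertex that follows the past `w` and the current vertex `v`. -/
noncomputable def next {V : Type*} {A : Arena V} (σ : EveStrategy A) (τ : AdamStrategy A)
    (w : List V) (v : V) : V :=
  if h : v ∈ A.eve then σ.move w ⟨v, h⟩ else τ.move w ⟨v, h⟩

/-- The past (most recent vertex first) and the current vertex after `n` steps, from `v₀`. -/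
noncomputable def position {V : Type*} {A : Arena V} (v₀ : V) (σ : EveStrategy A)
    (τ : AdamStrategy A) : ℕ → List V × V
  | 0 => ([], v₀)
  | n + 1 =>
    ((position v₀ σ τ n).2 :: (position v₀ σ τ n).1,
      next σ τ (position v₀ σ τ n).1 (position v₀ σ τ n).2)

/-- The play that results from the two strategies, starting from `v₀`. -/
noncomputable def play {V : Type*} {A : Arena V} (v₀ : V) (σ : EveStrategy A)
    (τ : AdamStrategy A) (n : ℕ) : V :=
  (position v₀ σ τ n).2

/-- `σ` is a winning strategy for Eve from the set `U` for the condition `Ω`. -/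
def EveStrategy.WinsFrom {V : Type*} {A : Arena V} (σ : EveStrategy A) (Ω : Set (ℕ → V))
    (U : Set V) : Prop :=
  ∀ v₀ ∈ U, ∀ τ : AdamStrategy A, play v₀ σ τ ∈ Ω

/-- Eve's winning set: the vertices from which Eve has a winning strategy. -/
def eveWinningSet {V : Type*} (A : Arena V) (Ω : Set (ℕ → V)) : Set V :=
  {v | ∃ σ : EveStrategy A, EveStrategy.WinsFrom σ Ω {v}}

/-- A memory structure with set of states `M`. The memory is updated along each edge `(u, v)`
taken (the values of `update` on pairs that are not edges play no role). -/
structure MemoryStructure (V M : Type*) where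
  init : M
  update : M → V → V → M

/-- The memory state reached once the vertices of `w` (most recent first), and then `v`,
have been visited. -/
def MemoryStructure.state {V M : Type*} (𝓜 : MemoryStructure V M) : List V → V → M
  | [], _ => 𝓜.init
  | u :: w, v => 𝓜.update (𝓜.state w u) u v

/-- `σ` relies on the memory structure `𝓜`: its moves are given by a next-move function of the
current vertex and the current memory state. -/
def EveStrategy.Uses {V M : Type*} {A : Arena V} (σ : EveStrategy A)
    (𝓜 : MemoryStructure V M) : Prop :=
  ∃ ν : A.eve → M → V, ∀ (w : List V) (v : A.eve), σ.move w v = ν v (𝓜.state w v)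

/-- `σ` is memoryless: its moves depend only on the current vertex. -/
def EveStrategy.Memoryless {V : Type*} {A : Arena V} (σ : EveStrategy A) : Prop :=
  ∃ ν : A.eve → V, ∀ (w : List V) (v : A.eve), σ.move w v = ν v

/-- The number of steps from the `k`-th vertex of the play to the next vertex of `F`
(`⊤` if there is none). -/
noncomputable def distBuchi {V : Type*} (F : Set V) (π : ℕ → V) (k : ℕ) : ℕ∞ :=
  ⨅ (k' : ℕ) (_ : k ≤ k' ∧ π k' ∈ F), ((k' - k : ℕ) : ℕ∞)

/-- The finitary Büchi condition. -/
def FinBuchi {V : Type*} (F : Set V) : Set (ℕ → V) :=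
  {π | Filter.limsup (distBuchi F π) Filter.atTop < ⊤}

/-- The number of steps from the `k`-th vertex of the play to the next vertex whose colour is even
and not larger than that of the `k`-th vertex (`⊤` if there is none). -/
noncomputable def distParity {V : Type*} {d : ℕ} (c : V → Fin (d + 1)) (π : ℕ → V) (k : ℕ) : ℕ∞ :=
  ⨅ (k' : ℕ) (_ : k ≤ k' ∧ Even (c (π k') : ℕ) ∧ c (π k') ≤ c (π k)), ((k' - k : ℕ) : ℕ∞)

/-- The finitary parity condition. -/
def FinParity {V : Type*} {d : ℕ} (c : V → Fin (d + 1)) : Set (ℕ → V) :=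
  {π | Filter.limsup (distParity c π) Filter.atTop < ⊤}

/-- The number of odd colours in `{0, …, d}`. -/
def numOddColours (d : ℕ) : ℕ := ((Finset.range (d + 1)).filter fun i => Odd i).card

end FinitaryGames

/-! Stack layers indexed by ordinals until no further layer fits: within a layer Eve can keep the
play there unless it drops into lower layers, and she can force answers to its requests within a
bound N depending only on the layer.

The union X of the layers contains Eve's winning set (`eveWinningSet_subset`). Suppose σ wins from a
vertex outside X. From outside, Eve cannot force the next vertex into X, since that would give a
one-vertex layer. If arbitrarily long delays stayed possible after every history avoiding X, Adam
could string longer and longer ones into a single play, against σ winning. So after some history the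
delays are uniformly bounded, and the vertices reachable from it under σ outside X form a new layer,
a contradiction.

Inside X, Eve works towards answering the smallest open request, whose answer also answers all
larger ones. The layer index never rises, so it is eventually constant; from then on that request is
answered or replaced by a smaller one within N steps, hence every delay is at most (d + 1) * N
(`mem_finParity_of_isProgress`). The memory is the smallest open request, an odd colour or none.
With colours 0 and 1, the Büchi case, the current vertex already determines it. -/

namespace FinitaryGames

universe u

variable {V : Type u}

/-! ### Exhausting a set by layers -/

/-- A layering that cannot be continued: the layers are the fibres of `ρ` on `X`, each of them
satisfies `P` relative to the union of the layers below, and no layer can be put on top. -/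
theorem exists_maximal_layering (P : Set V → Set V → Prop) :
    ∃ (X : Set V) (ρ : V → Ordinal.{u}),
      (∀ v ∈ X, P {u | u ∈ X ∧ ρ u < ρ v} {u | u ∈ X ∧ ρ u = ρ v}) ∧
      ∀ D : Set V, D.Nonempty → Disjoint D X → ¬ P X D := by
  classical
  let g : Set V → Set V := fun X =>
    if h : ∃ D : Set V, D.Nonempty ∧ Disjoint D X ∧ P X D then h.choose else ∅
  have hg : ∀ X, (g X).Nonempty → Disjoint (g X) X ∧ P X (g X) := by
    intro X hX
    by_cases h : ∃ D : Set V, D.Nonempty ∧ Disjoint D X ∧ P X D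
    · simpa [g, h] using h.choose_spec.2
    · simp [g, h] at hX
  have hg' : ∀ X, ¬ (g X).Nonempty → ∀ D : Set V, D.Nonempty → Disjoint D X → ¬ P X D := by
    intro X hX D h1 h2 h3
    have h : ∃ D : Set V, D.Nonempty ∧ Disjoint D X ∧ P X D := ⟨D, h1, h2, h3⟩
    exact hX (by simpa [g, h] using h.choose_spec.1)
  let L : Ordinal.{u} → Set V :=
    WellFounded.fix (C := fun _ => Set V) (wellFounded_lt (α := Ordinal.{u}))
      fun α ih => g (⋃ β : Set.Iio α, ih β.1 β.2)
  have hL : ∀ α, L α = g (⋃ β : Set.Iio α, L β.1) := fun α => WellFounded.fix_eq _ _ α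
  have hdisj : ∀ α β v, β < α → v ∈ L α → v ∉ L β := by
    intro α β v hlt hα hβ
    have h := (hg (⋃ β : Set.Iio α, L β.1) (by rw [← hL]; exact ⟨v, hα⟩)).1
    rw [← hL] at h
    exact Set.disjoint_left.1 h hα (Set.mem_iUnion.2 ⟨⟨β, hlt⟩, hβ⟩)
  have huniq : ∀ α β v, v ∈ L α → v ∈ L β → α = β := by
    intro α β v hα hβ
    rcases lt_trichotomy α β with h | h | h
    · exact absurd hα (hdisj _ _ _ h hβ)
    · exact h
    · exact absurd hβ (hdisj _ _ _ h hα)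
  -- The layers are pairwise disjoint; if none were empty, choosing a point in each would inject the
  -- ordinals of universe `u` into `V : Type u`.
  obtain ⟨α, hα⟩ : ∃ α, ¬ (L α).Nonempty := by
    by_contra! h
    choose f hf using h
    exact not_injective_of_ordinal f fun a b hab => huniq a b (f a) (hf a) (hab ▸ hf b)
  let ρ : V → Ordinal.{u} := fun v => if h : ∃ β, v ∈ L β then h.choose else 0
  have hρ : ∀ v β, v ∈ L β → ρ v = β := by
    intro v β hv
    have h : ∃ β, v ∈ L β := ⟨β, hv⟩
    have : ρ v = h.choose := by simp [ρ, h]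
    rw [this]
    exact huniq _ _ v h.choose_spec hv
  refine ⟨⋃ β : Set.Iio α, L β.1, ρ, ?_, ?_⟩
  · intro v hv
    obtain ⟨⟨β, hβ⟩, hv⟩ := Set.mem_iUnion.1 hv
    have hmem : ∀ u, u ∈ (⋃ β : Set.Iio α, L β.1) → u ∈ L (ρ u) := by
      intro u hu
      obtain ⟨γ, hu⟩ := Set.mem_iUnion.1 hu
      rwa [hρ u _ hu]
    have e1 : {u | u ∈ (⋃ β : Set.Iio α, L β.1) ∧ ρ u < ρ v} = ⋃ γ : Set.Iio β, L γ.1 := by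
      ext u
      rw [hρ v β hv]
      constructor
      · rintro ⟨h1, h2⟩
        exact Set.mem_iUnion.2 ⟨⟨ρ u, h2⟩, hmem u h1⟩
      · intro h
        obtain ⟨⟨γ, hγ⟩, hu⟩ := Set.mem_iUnion.1 h
        refine ⟨Set.mem_iUnion.2 ⟨⟨γ, (Set.mem_Iio.1 hγ).trans hβ⟩, hu⟩, ?_⟩
        rw [hρ u γ hu]; exact hγ
    have e2 : {u | u ∈ (⋃ β : Set.Iio α, L β.1) ∧ ρ u = ρ v} = L β := by
      ext u
      rw [hρ v β hv]
      constructor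
      · rintro ⟨h1, h2⟩
        exact h2 ▸ hmem u h1
      · exact fun h => ⟨Set.mem_iUnion.2 ⟨⟨β, hβ⟩, h⟩, hρ u β h⟩
    rw [e1, e2]
    have := (hg (⋃ γ : Set.Iio β, L γ.1) (by rw [← hL]; exact ⟨v, hv⟩)).2
    rwa [← hL] at this
  · exact hg' _ (by rwa [← hL])

/-! ### The finitary parity condition -/

/-- The vertex `v` answers a request of colour `i`. -/
def Answers (c : V → ℕ) (i : ℕ) (v : V) : Prop := Even (c v) ∧ c v ≤ i

theorem distParity_le {d : ℕ} {c : V → Fin (d + 1)} {π : ℕ → V} {k j N : ℕ} (hj : j ≤ N)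
    (h : Answers (fun v => (c v : ℕ)) (c (π k)) (π (k + j))) : distParity c π k ≤ N := by
  refine (iInf₂_le (k + j) ⟨Nat.le_add_right _ _, h.1, Fin.le_def.2 h.2⟩).trans ?_
  simpa using hj

theorem lt_distParity {d : ℕ} {c : V → Fin (d + 1)} {π : ℕ → V} {k N : ℕ}
    (h : ∀ j ≤ N, ¬ Answers (fun v => (c v : ℕ)) (c (π k)) (π (k + j))) :
    (N : ℕ∞) < distParity c π k := by
  refine lt_of_lt_of_le (b := ((N + 1 : ℕ) : ℕ∞)) (by exact_mod_cast Nat.lt_succ_self N) ?_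
  refine le_iInf₂ fun k' ⟨h1, h2, h3⟩ => ?_
  obtain ⟨j, rfl⟩ := Nat.exists_eq_add_of_le h1
  by_contra hlt
  exact h j (by simp only [Nat.cast_le] at hlt; omega) ⟨h2, h3⟩

theorem mem_finParity_iff {d : ℕ} {c : V → Fin (d + 1)} {π : ℕ → V} :
    π ∈ FinParity c ↔ ∃ N : ℕ, ∀ᶠ k in Filter.atTop, distParity c π k ≤ N := by
  constructor
  · intro h
    obtain ⟨n, hn⟩ := ENat.ne_top_iff_exists.1 (ne_of_lt h)
    refine ⟨n + 1, ?_⟩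
    have : Filter.limsup (distParity c π) Filter.atTop < ((n + 1 : ℕ) : ℕ∞) := by
      rw [← hn]; exact_mod_cast Nat.lt_succ_self n
    exact (Filter.eventually_lt_of_limsup_lt this).mono fun k hk => hk.le
  · rintro ⟨N, hN⟩
    exact lt_of_le_of_lt (Filter.limsup_le_of_le (by isBoundedDefault) hN) (ENat.natCast_lt_top N)

-- The two distances agree pointwise: on `F` both vanish, and off `F` the request has colour 1,
-- whose answers are exactly the visits to `F`.
open Classical in
theorem finBuchi_eq_finParity (F : Set V) :
    FinBuchi F = FinParity (d := 1) fun v => if v ∈ F then 0 else 1 := by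
  have : ∀ π : ℕ → V, distBuchi F π =
      distParity (d := 1) (fun v => if v ∈ F then 0 else 1) π := by
    intro π
    funext k
    by_cases hk : π k ∈ F
    · have h1 : distBuchi F π k ≤ 0 := (iInf₂_le k ⟨le_rfl, hk⟩).trans (by simp)
      have h2 : distParity (d := 1) (fun v => if v ∈ F then 0 else 1) π k ≤ 0 :=
        (iInf₂_le k ⟨le_rfl, by simp [hk], le_rfl⟩).trans (by simp)
      rw [le_zero_iff.1 h1, le_zero_iff.1 h2]
    · unfold distBuchi distParity
      refine iInf_congr fun k' => iInf_congr_Prop ?_ fun _ => rfl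
      by_cases hk' : π k' ∈ F <;> simp [hk, hk']
  simp only [FinBuchi, FinParity, this]

/-! ### Forcing an answer -/

/-- Eve can make sure that the successor of `v` is in `S`. -/
def ControlledPre (A : Arena V) (S : Set V) (v : V) : Prop :=
  (v ∈ A.eve → ∃ u, A.Edge v u ∧ u ∈ S) ∧ (v ∉ A.eve → ∀ u, A.Edge v u → u ∈ S)

/-- From `v`, Eve can make sure that within `n` steps the play answers a request of colour `i`
or enters `X`, and that it remains in `D` until then. -/
def ForcesAnswer (A : Arena V) (c : V → ℕ) (X D : Set V) (i : ℕ) : ℕ → V → Prop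
  | 0, v => Answers c i v
  | n + 1, v => Answers c i v ∨
      ControlledPre A {u | u ∈ X ∨ u ∈ D ∧ ForcesAnswer A c X D i n u} v

/-- Eve can keep the play in `D` unless it enters `X`, and from the vertices of `D` she can force
their requests to be answered within a uniform number of steps, unless the play enters `X`. -/
def IsLayer (A : Arena V) (c : V → ℕ) (X D : Set V) : Prop :=
  ∃ N : ℕ, ∀ v ∈ D, ControlledPre A {u | u ∈ X ∨ u ∈ D} v ∧
    (Odd (c v) → ∃ n ≤ N, ForcesAnswer A c X D (c v) n v)

/-- Entering `X` discharges every obligation, so the bound 1 suffices. Hence outside a maximal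
layering Eve can never force the next vertex into it. -/
theorem isLayer_singleton {A : Arena V} {c : V → ℕ} {X : Set V} {v : V}
    (h : ControlledPre A X v) : IsLayer A c X {v} := by
  have key : ∀ S : Set V, X ⊆ S → ControlledPre A S v := fun S hS =>
    ⟨fun hv => (h.1 hv).imp fun u hu => ⟨hu.1, hS hu.2⟩, fun hv u hu => hS (h.2 hv u hu)⟩
  refine ⟨1, fun u hu => ?_⟩
  rw [Set.mem_singleton_iff.1 hu]
  exact ⟨key _ fun u hu => Or.inl hu, fun _ => ⟨1, le_rfl, Or.inr (key _ fun u hu => Or.inl hu)⟩⟩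

/-! ### Open requests -/

/-- The smallest open request after a vertex of colour `a`, if it was `m` before; `d + 1` stands
for the absence of an open request. -/
def openRequest (d m a : ℕ) : ℕ :=
  if Even a then (if a ≤ m then d + 1 else m) else min m a

/-- If the smallest open request is always answered, or replaced by a smaller one, within `N`
steps, then all requests are answered within `(d + 1) * N` steps. -/
theorem exists_answer_of_progress {d N K : ℕ} {f e : ℕ → ℕ} {F : ℕ → ℕ → ℕ → Prop}
    (hfin : ∀ n ≥ K, e n ≤ d → ∃ k ≤ N, F (e n) k n)
    (hstep : ∀ n ≥ K, ∀ k, e n ≤ d → F (e n) k n →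
      e (n + 1) = openRequest d (e n) (f (n + 1)) ∧ ∃ k' < k, F (e n) k' (n + 1)) :
    ∀ i n, K ≤ n → e n = i → i ≤ d → ∃ j ≤ (i + 1) * N, Even (f (n + j)) ∧ f (n + j) ≤ i := by
  -- The rank `k` drops at each step while the request is unchanged, so the request is answered or
  -- shrinks within `k` steps.
  have key : ∀ k n i, K ≤ n → e n = i → i ≤ d → F i k n →
      ∃ j ≤ k, (Even (f (n + j)) ∧ f (n + j) ≤ i) ∨ e (n + j) < i := by
    intro k
    induction k using Nat.strong_induction_on with
    | _ k ih =>
      rintro n i hn rfl hi hF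
      obtain ⟨he, k', hk', hF'⟩ := hstep n hn k hi hF
      by_cases h1 : Even (f (n + 1)) ∧ f (n + 1) ≤ e n
      · exact ⟨1, by omega, Or.inl h1⟩
      by_cases h2 : e (n + 1) < e n
      · exact ⟨1, by omega, Or.inr h2⟩
      have h3 : e (n + 1) = e n := by
        unfold openRequest at he
        split_ifs at he with h4 h5
        · exact absurd ⟨h4, h5⟩ h1
        · exact he
        · rcases le_total (e n) (f (n + 1)) with h | h
          · rwa [min_eq_left h] at he
          · rw [min_eq_right h] at he; omega
      obtain ⟨j, hj, hj'⟩ := ih k' hk' (n + 1) (e n) (by omega) h3 hi hF'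
      refine ⟨j + 1, by omega, ?_⟩
      rwa [show n + (j + 1) = n + 1 + j by omega]
  intro i
  induction i using Nat.strong_induction_on with
  | _ i ih =>
    intro n hn he hi
    obtain ⟨k, hk, hF⟩ := hfin n hn (he ▸ hi)
    obtain ⟨j, hj, h | h⟩ := key k n i hn he hi (he ▸ hF)
    · exact ⟨j, by nlinarith, h⟩
    -- An answer to the smaller request also answers `i`; it costs at most `i * N` steps beyond the
    -- `N` already spent.
    · obtain ⟨j', hj', h'⟩ := ih _ h (n + j) (by omega) rfl (by omega)
      refine ⟨j + j', ?_, ?_⟩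
      · have : (e (n + j) + 1) * N ≤ i * N := Nat.mul_le_mul_right _ h
        nlinarith
      · rw [← add_assoc]; exact ⟨h'.1, by omega⟩

/-! ### Plays against a fixed strategy of Eve -/

/-- The history `h'` extends `h` by one step that is consistent with `σ` and leads into `C`. -/
def ConsistentStep {A : Arena V} (σ : EveStrategy A) (C : Set V) (h h' : List V × V) : Prop :=
  h'.1 = h.2 :: h.1 ∧ A.Edge h.2 h'.2 ∧ h'.2 ∈ C ∧
    ∀ hv : h.2 ∈ A.eve, h'.2 = σ.move h.1 ⟨h.2, hv⟩

/-- All extensions of `h` that are consistent with `σ` and remain in `C` answer a request of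
colour `i` within `n` steps. -/
def MustAnswer {A : Arena V} (c : V → ℕ) (σ : EveStrategy A) (C : Set V) (i : ℕ) :
    ℕ → List V × V → Prop
  | 0, h => Answers c i h.2
  | n + 1, h => Answers c i h.2 ∨ ∀ h', ConsistentStep σ C h h' → MustAnswer c σ C i n h'

theorem MustAnswer.of_answers {A : Arena V} {c : V → ℕ} {σ : EveStrategy A} {C : Set V} {i : ℕ}
    {h : List V × V} (hh : Answers c i h.2) : ∀ n, MustAnswer c σ C i n h
  | 0 => hh
  | _ + 1 => Or.inl hh

open Relation

/-- There is an `R`-path of length `n` from the point to `S`. -/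
def CanReachIn {α : Type*} (R : α → α → Prop) (S : α → Prop) : ℕ → α → Prop
  | 0, a => S a
  | n + 1, a => ∃ b, R a b ∧ CanReachIn R S n b

/-- If every point reachable from `a₀` has a successor, and from every such point each of the sets
`G N` can be reached, then some infinite path from `a₀` visits all of them. -/
theorem exists_path_meeting {α : Type*} {R : α → α → Prop} {G : ℕ → α → Prop} {a₀ : α}
    (hR : ∀ a, ReflTransGen R a₀ a → ∃ b, R a b)
    (hG : ∀ N a, ReflTransGen R a₀ a → ∃ b, ReflTransGen R a b ∧ G N b) :
    ∃ H : ℕ → α, H 0 = a₀ ∧ (∀ n, R (H n) (H (n + 1))) ∧ ∀ N, ∃ n, G N (H n) := by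
  classical
  let T : ℕ → ℕ → α → Prop := fun N => CanReachIn R (G N)
  have hT : ∀ N a, ReflTransGen R a₀ a → ∃ n, T N n a := by
    intro N a ha
    obtain ⟨b, hab, hb⟩ := hG N a ha
    clear ha
    induction hab using ReflTransGen.head_induction_on with
    | refl => exact ⟨0, hb⟩
    | head h _ ih =>
      obtain ⟨n, hn⟩ := ih
      exact ⟨n + 1, _, h, hn⟩
  -- Each point carries the index of its current target: a step either advances the index, if the
  -- target is met, or shortens the distance to it.
  have hnext : ∀ p : {p : ℕ × α // ReflTransGen R a₀ p.2},
      ∃ q : {p : ℕ × α // ReflTransGen R a₀ p.2}, R p.1.2 q.1.2 ∧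
        (G p.1.1 p.1.2 → q.1.1 = p.1.1 + 1) ∧
        (¬ G p.1.1 p.1.2 → q.1.1 = p.1.1 ∧
          ∀ n, T p.1.1 n p.1.2 → ∃ m < n, T p.1.1 m q.1.2) := by
    rintro ⟨⟨N, a⟩, ha⟩
    by_cases h : G N a
    · obtain ⟨b, hb⟩ := hR a ha
      exact ⟨⟨(N + 1, b), ha.tail hb⟩, hb, fun _ => rfl, fun h' => absurd h h'⟩
    · have hex := hT N a ha
      obtain ⟨n, hn, hmin⟩ : ∃ n, T N n a ∧ ∀ m, T N m a → n ≤ m :=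
        ⟨Nat.find hex, Nat.find_spec hex, fun m hm => Nat.find_min' hex hm⟩
      cases n with
      | zero => exact absurd hn h
      | succ n =>
        obtain ⟨b, hb, hTb⟩ := hn
        exact ⟨⟨(N, b), ha.tail hb⟩, hb, fun h' => absurd h' h,
          fun _ => ⟨rfl, fun m hm => ⟨n, hmin m hm, hTb⟩⟩⟩
  choose f hf1 hf2 hf3 using hnext
  let s : ℕ → {p : ℕ × α // ReflTransGen R a₀ p.2} := fun n => f^[n] ⟨(0, a₀), .refl⟩
  have hs : ∀ n, s (n + 1) = f (s n) := fun n => Function.iterate_succ_apply' f n _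
  have hmeet : ∀ k N n, (s n).1.1 = N → T N k (s n).1.2 → ∃ m, (s m).1.1 = N ∧ G N (s m).1.2 := by
    intro k
    induction k using Nat.strong_induction_on with
    | _ k ih =>
      rintro N n rfl hk
      by_cases h : G (s n).1.1 (s n).1.2
      · exact ⟨n, rfl, h⟩
      · obtain ⟨h1, h2⟩ := hf3 (s n) h
        obtain ⟨m, hm, hm'⟩ := h2 k hk
        exact ih m hm _ (n + 1) (by rw [hs, h1]) (by rw [hs]; exact hm')
  have hstage : ∀ N, ∃ n, (s n).1.1 = N := by
    intro N
    induction N with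
    | zero => exact ⟨0, rfl⟩
    | succ N ih =>
      obtain ⟨n, hn⟩ := ih
      obtain ⟨k, hk⟩ := hT N _ (s n).2
      obtain ⟨m, hm, hm'⟩ := hmeet k N n hn hk
      exact ⟨m + 1, by rw [hs, hf2 (s m) (by rwa [hm]), hm]⟩
  refine ⟨fun n => (s n).1.2, rfl, fun n => ?_, fun N => ?_⟩
  · simp only [hs]
    exact hf1 (s n)
  · obtain ⟨n, hn⟩ := hstage N
    obtain ⟨k, hk⟩ := hT N _ (s n).2
    obtain ⟨m, _, hm⟩ := hmeet k N n hn hk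
    exact ⟨m, hm⟩

theorem length_past {A : Arena V} {σ : EveStrategy A} {C : Set V} {v₀ : V} {H : ℕ → List V × V}
    (h0 : H 0 = ([], v₀)) (hH : ∀ n, ConsistentStep σ C (H n) (H (n + 1))) (n : ℕ) :
    (H n).1.length = n := by
  induction n with
  | zero => simp [h0]
  | succ n ih => simp [(hH n).1, ih]

/-- Adam can realise every infinite sequence of consistent steps. -/
theorem exists_adamStrategy_position_eq {A : Arena V} {σ : EveStrategy A} {C : Set V} {v₀ : V}
    {H : ℕ → List V × V} (h0 : H 0 = ([], v₀))
    (hH : ∀ n, ConsistentStep σ C (H n) (H (n + 1))) :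
    ∃ τ : AdamStrategy A, ∀ n, position v₀ σ τ n = H n := by
  classical
  -- Adam reads the time off the length of the past and follows `H`; the other branch only keeps the
  -- strategy legal off this play.
  let τ : AdamStrategy A :=
    { move := fun w v => if A.Edge v (H (w.length + 1)).2 then (H (w.length + 1)).2
        else (A.no_dead_end v).choose
      legal := by
        intro w v
        split_ifs with h
        · exact h
        · exact (A.no_dead_end v).choose_spec }
  refine ⟨τ, fun n => ?_⟩
  induction n with
  | zero => exact h0.symm
  | succ n ih =>
    obtain ⟨h1, h2, -, h3⟩ := hH n
    refine Prod.ext ?_ ?_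
    · simp [position, ih, h1]
    · simp only [position, ih, next]
      split_ifs with hv
      · exact (h3 hv).symm
      · have hlen := length_past h0 hH n
        have : A.Edge (H n).2 (H ((H n).1.length + 1)).2 := by rwa [hlen]
        simp only [τ, this, if_true]
        rw [hlen]

theorem getElem?_history {A : Arena V} {σ : EveStrategy A} {C : Set V}
    {H : ℕ → List V × V}
    (hH : ∀ n, ConsistentStep σ C (H n) (H (n + 1))) (n j : ℕ) (hj : j ≤ n) :
    ((H n).2 :: (H n).1)[j]? = some (H (n - j)).2 := by
  induction n generalizing j with
  | zero => obtain rfl : j = 0 := by omega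
            simp
  | succ n ih =>
    cases j with
    | zero => simp
    | succ j =>
      rw [List.getElem?_cons_succ, (hH n).1, ih j (by omega), Nat.add_sub_add_right]

/-- Each failure of `MustAnswer` passes to some consistent successor; `a` collects the `n` vertices
so added, most recent first. -/
theorem exists_avoiding_of_not_mustAnswer {A : Arena V} {c : V → ℕ} {σ : EveStrategy A}
    {C : Set V} {i : ℕ} : ∀ (n : ℕ) (h : List V × V), ¬ MustAnswer c σ C i n h →
    ∃ h', ReflTransGen (ConsistentStep σ C) h h' ∧ ∃ a : List V,
      h'.2 :: h'.1 = a ++ h.2 :: h.1 ∧ a.length = n ∧ ∀ y ∈ a, ¬ Answers c i y := by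
  intro n
  induction n with
  | zero => exact fun h _ => ⟨h, .refl, [], rfl, rfl, by simp⟩
  | succ n ih =>
    intro h hh
    have hh' : ∃ h', ConsistentStep σ C h h' ∧ ¬ MustAnswer c σ C i n h' := by
      by_contra! hcon
      exact hh (Or.inr hcon)
    obtain ⟨h', hs, hm⟩ := hh'
    obtain ⟨h'', hr, a, h1, h2, h3⟩ := ih h' hm
    refine ⟨h'', hr.head hs, a ++ [h'.2], ?_, by simp [h2], ?_⟩
    · rw [h1, hs.1]; simp
    · intro y hy
      rcases List.mem_append.1 hy with hy | hy
      · exact h3 y hy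
      · rw [List.mem_singleton.1 hy]
        exact fun ha => hm (.of_answers ha n)

theorem length_le_of_reflTransGen {A : Arena V} {σ : EveStrategy A} {C : Set V}
    {h h' : List V × V} (hr : ReflTransGen (ConsistentStep σ C) h h') :
    h.1.length ≤ h'.1.length := by
  induction hr with
  | refl => exact le_rfl
  | tail _ hs ih => rw [hs.1]; simp; omega

section Complement

variable {A : Arena V} {d : ℕ} {c : V → Fin (d + 1)} {X : Set V}

/-- Outside `X`, no move of Eve enters `X`, whatever σ prescribes, and Adam always has a move that
avoids it. -/
theorem exists_consistentStep (σ : EveStrategy A) (hX : ∀ v ∉ X, ¬ ControlledPre A X v)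
    {h : List V × V} (hh : h.2 ∉ X) : ∃ h', ConsistentStep σ Xᶜ h h' := by
  by_cases hv : h.2 ∈ A.eve
  · refine ⟨(h.2 :: h.1, σ.move h.1 ⟨h.2, hv⟩), rfl, σ.legal _ ⟨h.2, hv⟩, fun hmem => ?_, fun _ => rfl⟩
    exact hX _ hh ⟨fun _ => ⟨_, σ.legal _ ⟨h.2, hv⟩, hmem⟩, fun hv' => absurd hv hv'⟩
  · have : ∃ u, A.Edge h.2 u ∧ u ∉ X := by
      by_contra! hcon
      exact hX _ hh ⟨fun hv' => absurd hv' hv, fun _ => hcon⟩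
    obtain ⟨u, hu, huX⟩ := this
    exact ⟨(h.2 :: h.1, u), rfl, hu, huX, fun hv' => absurd hv' hv⟩

theorem notMem_of_reflTransGen {σ : EveStrategy A} {h h' : List V × V} (hh : h.2 ∉ X)
    (hr : ReflTransGen (ConsistentStep σ Xᶜ) h h') : h'.2 ∉ X := by
  cases hr with
  | refl => exact hh
  | tail _ hs => exact hs.2.2.1

/-- If Eve wins from a vertex outside `X`, and cannot force the play into `X`, then she bounds the
answering times uniformly after some history. -/
theorem exists_mustAnswer (hX : ∀ v ∉ X, ¬ ControlledPre A X v) {v₀ : V} (hv₀ : v₀ ∉ X)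
    {σ : EveStrategy A} (hσ : EveStrategy.WinsFrom σ (FinParity c) {v₀}) :
    ∃ h N, h.2 ∉ X ∧ ∀ h', ReflTransGen (ConsistentStep σ Xᶜ) h h' → Odd (c h'.2 : ℕ) →
      MustAnswer (fun v => (c v : ℕ)) σ Xᶜ (c h'.2) N h' := by
  by_contra! hcon
  -- The request `x` stays unanswered for `N` steps and occurs no earlier than time `N`. The second
  -- demand is needed because a limsup ignores early delays.
  let G : ℕ → List V × V → Prop := fun N h => ∃ a x b, h.2 :: h.1 = a ++ x :: b ∧
    N ≤ a.length ∧ N ≤ b.length ∧ Odd (c x : ℕ) ∧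
    ∀ y ∈ a, ¬ Answers (fun v => (c v : ℕ)) (c x) y
  have hlong : ∀ N (h : List V × V), h.2 ∉ X →
      ∃ h', ReflTransGen (ConsistentStep σ Xᶜ) h h' ∧ N ≤ h'.1.length := by
    intro N h hh
    induction N with
    | zero => exact ⟨h, .refl, Nat.zero_le _⟩
    | succ N ih =>
      obtain ⟨h', hr, hl⟩ := ih
      obtain ⟨h'', hs⟩ := exists_consistentStep σ hX (notMem_of_reflTransGen hh hr)
      exact ⟨h'', hr.tail hs, by rw [hs.1]; simpa using hl⟩
  obtain ⟨H, h0, hH, hG⟩ := exists_path_meeting (R := ConsistentStep σ Xᶜ) (G := G)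
    (a₀ := (([] : List V), v₀))
    (fun h hr => exists_consistentStep σ hX (notMem_of_reflTransGen hv₀ hr)) (by
      intro N h hr
      have hh := notMem_of_reflTransGen hv₀ hr
      obtain ⟨h1, hr1, hl⟩ := hlong N h hh
      obtain ⟨h2, hr2, hodd, hm⟩ := hcon h1 N (notMem_of_reflTransGen hh hr1)
      obtain ⟨h3, hr3, a, e1, e2, e3⟩ := exists_avoiding_of_not_mustAnswer N h2 hm
      exact ⟨h3, (hr1.trans hr2).trans hr3, a, h2.2, h2.1, e1, e2.ge,
        hl.trans (length_le_of_reflTransGen hr2), hodd, e3⟩)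
  obtain ⟨τ, hτ⟩ := exists_adamStrategy_position_eq h0 hH
  obtain ⟨B, hB⟩ := mem_finParity_iff.1 (hσ v₀ rfl τ)
  obtain ⟨K, hK⟩ := Filter.eventually_atTop.1 hB
  obtain ⟨n, a, x, b, e, ha, hb, hodd, hav⟩ := hG (max B K)
  have hplay : ∀ m, play v₀ σ τ m = (H m).2 := fun m => by rw [play, hτ]
  have hlen : n = a.length + b.length := by
    have := congrArg List.length e
    simp [length_past h0 hH] at this
    omega
  have hx : play v₀ σ τ b.length = x := by
    have := getElem?_history hH n a.length (by omega)
    rw [e, show n - a.length = b.length by omega] at this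
    rw [hplay]
    simpa using this.symm
  refine absurd (hK b.length (le_trans (le_max_right _ _) hb)) (not_le_of_gt ?_)
  refine lt_distParity fun j hj hans => ?_
  rw [hx] at hans
  rcases Nat.eq_zero_or_pos j with rfl | hpos
  · rw [show play v₀ σ τ (b.length + 0) = x from hx] at hans
    exact (Nat.not_even_iff_odd.2 hodd) hans.1
  · have hja : j ≤ a.length := hj.trans ((le_max_left _ _).trans ha)
    have := getElem?_history hH n (a.length - j) (by omega)
    rw [e, List.getElem?_append_left (by omega),
      show n - (a.length - j) = b.length + j by omega, ← hplay] at this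
    exact hav _ (List.mem_of_getElem? this) hans

/-- Following σ turns a bound on histories into forcing on vertices: an Adam move into `X` is
allowed by `ForcesAnswer`, and all other moves are consistent steps. -/
theorem MustAnswer.forcesAnswer {c : V → ℕ} (hX : ∀ v ∉ X, ¬ ControlledPre A X v)
    {σ : EveStrategy A} {h₀ : List V × V} (hh₀ : h₀.2 ∉ X) {i : ℕ} :
    ∀ (n : ℕ) (h : List V × V), ReflTransGen (ConsistentStep σ Xᶜ) h₀ h →
      MustAnswer c σ Xᶜ i n h →
      ForcesAnswer A c X {v | ∃ w, ReflTransGen (ConsistentStep σ Xᶜ) h₀ (w, v)} i n h.2 := by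
  intro n
  induction n with
  | zero => exact fun h _ hm => hm
  | succ n ih =>
    rintro h hr (hm | hm)
    · exact Or.inl hm
    refine Or.inr ⟨fun hv => ?_, fun hv u hu => ?_⟩
    · have hs : ConsistentStep σ Xᶜ h (h.2 :: h.1, σ.move h.1 ⟨h.2, hv⟩) := by
        refine ⟨rfl, σ.legal _ ⟨h.2, hv⟩, fun hmem => ?_, fun _ => rfl⟩
        exact hX _ (notMem_of_reflTransGen hh₀ hr)
          ⟨fun _ => ⟨_, σ.legal _ ⟨h.2, hv⟩, hmem⟩, fun hv' => absurd hv hv'⟩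
      exact ⟨_, hs.2.1, Or.inr ⟨⟨_, hr.tail hs⟩, ih _ (hr.tail hs) (hm _ hs)⟩⟩
    · by_cases huX : u ∈ X
      · exact Or.inl huX
      · have hs : ConsistentStep σ Xᶜ h (h.2 :: h.1, u) :=
          ⟨rfl, hu, huX, fun hv' => absurd hv' hv⟩
        exact Or.inr ⟨⟨_, hr.tail hs⟩, ih _ (hr.tail hs) (hm _ hs)⟩

/-- The winning set of Eve is contained in every set on top of which no layer can be put. -/
theorem eveWinningSet_subset
    (hX : ∀ D : Set V, D.Nonempty → Disjoint D X → ¬ IsLayer A (fun v => (c v : ℕ)) X D) :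
    eveWinningSet A (FinParity c) ⊆ X := by
  rintro v₀ ⟨σ, hσ⟩
  by_contra hv₀
  have hpre : ∀ v ∉ X, ¬ ControlledPre A X v := fun v hv h =>
    hX {v} (Set.singleton_nonempty v) (Set.disjoint_singleton_left.2 hv) (isLayer_singleton h)
  obtain ⟨h₀, N, hh₀, hm⟩ := exists_mustAnswer hpre hv₀ hσ
  refine hX {v | ∃ w, ReflTransGen (ConsistentStep σ Xᶜ) h₀ (w, v)} ⟨h₀.2, h₀.1, .refl⟩ ?_
    ⟨N, ?_⟩
  · rw [Set.disjoint_left]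
    rintro v ⟨w, hr⟩
    exact notMem_of_reflTransGen hh₀ hr
  · rintro v ⟨w, hr⟩
    refine ⟨⟨fun hv => ?_, fun hv u hu => ?_⟩,
      fun hodd => ⟨N, le_rfl, MustAnswer.forcesAnswer hpre hh₀ N (w, v) hr (hm _ hr hodd)⟩⟩
    · obtain ⟨⟨w', u⟩, hs⟩ := exists_consistentStep σ hpre (notMem_of_reflTransGen hh₀ hr)
      exact ⟨u, hs.2.1, Or.inr ⟨w', hr.tail hs⟩⟩
    · by_cases huX : u ∈ X
      · exact Or.inl huX
      · exact Or.inr ⟨v :: w, hr.tail ⟨rfl, hu, huX, fun hv' => absurd hv' hv⟩⟩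

end Complement

/-! ### The strategy that answers the smallest open request -/

/-- The odd colours up to `d`, and `d + 1` for the absence of an open request. -/
def requestStates (d : ℕ) : Finset ℕ :=
  insert (d + 1) ((Finset.range (d + 1)).filter fun i => Odd i)

theorem mem_requestStates {d m : ℕ} : m ∈ requestStates d ↔ m = d + 1 ∨ m ≤ d ∧ Odd m := by
  simp [requestStates]

theorem card_requestStates_le (d : ℕ) : (requestStates d).card ≤ numOddColours d + 1 :=
  Finset.card_insert_le _ _

theorem openRequest_mem {d m a : ℕ} (hm : m ∈ requestStates d) (ha : a ≤ d) :
    openRequest d m a ∈ requestStates d := by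
  rw [mem_requestStates] at *
  unfold openRequest
  split_ifs with h1 h2
  · exact Or.inl rfl
  · exact hm
  · rcases le_total m a with h | h
    · rwa [min_eq_left h]
    · rw [min_eq_right h]
      exact Or.inr ⟨ha, Nat.not_even_iff_odd.1 h1⟩

/-- The result does not depend on `m`, which is why no memory is needed for Büchi. -/
theorem openRequest_one {m a : ℕ} (hm : m ∈ requestStates 1) (ha : a ≤ 1) :
    openRequest 1 m a = if a = 0 then 2 else 1 := by
  rw [mem_requestStates] at hm
  have hm1 : 1 ≤ m := by
    rcases hm with h | ⟨-, h⟩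
    · omega
    · exact h.pos
  interval_cases a
  · simp [openRequest]
  · simp [openRequest, hm1]

theorem not_answered_of_openRequest_le {d m a : ℕ} (h : openRequest d m a ≤ d) :
    ¬ (Even a ∧ a ≤ openRequest d m a) := by
  rintro ⟨h1, h2⟩
  unfold openRequest at h h2
  simp only [h1, if_true] at h h2
  split_ifs at h h2 <;> omega

/-- In the layering of `X` by `ρ`, the move from `v` to `u` stays in `X`, does not climb, and makes
progress towards an answer to a request of colour `e`. -/
def IsProgress (A : Arena V) (c : V → ℕ) (X : Set V) (ρ : V → Ordinal.{u}) (e : ℕ) (v u : V) :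
    Prop :=
  u ∈ X ∧ ρ u ≤ ρ v ∧ ∀ k,
    ForcesAnswer A c {x | x ∈ X ∧ ρ x < ρ v} {x | x ∈ X ∧ ρ x = ρ v} e k v → ¬ Answers c e v →
      ∃ k' < k, ρ u = ρ v →
        ForcesAnswer A c {x | x ∈ X ∧ ρ x < ρ v} {x | x ∈ X ∧ ρ x = ρ v} e k' u

theorem mem_and_le_of_mem_layers {X : Set V} {ρ : V → Ordinal.{u}} {α : Ordinal.{u}} {u : V}
    (h : u ∈ {x | x ∈ {x | x ∈ X ∧ ρ x < α} ∨ x ∈ {x | x ∈ X ∧ ρ x = α}}) : u ∈ X ∧ ρ u ≤ α := by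
  rcases h with h | h
  · exact ⟨h.1, h.2.le⟩
  · exact ⟨h.1, h.2.le⟩

section Strategy

variable {A : Arena V} {c : V → ℕ} {X : Set V} {ρ : V → Ordinal.{u}}

theorem exists_isProgress
    (hlay : ∀ v ∈ X, IsLayer A c {u | u ∈ X ∧ ρ u < ρ v} {u | u ∈ X ∧ ρ u = ρ v})
    (v : V) (e : ℕ) : ∃ u, A.Edge v u ∧ (v ∈ A.eve → v ∈ X → IsProgress A c X ρ e v u) := by
  classical
  by_cases hv : v ∈ A.eve ∧ v ∈ X
  swap
  · obtain ⟨u, hu⟩ := A.no_dead_end v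
    exact ⟨u, hu, fun h1 h2 => absurd ⟨h1, h2⟩ hv⟩
  by_cases hex : (∃ k, ForcesAnswer A c {x | x ∈ X ∧ ρ x < ρ v} {x | x ∈ X ∧ ρ x = ρ v} e k v) ∧
      ¬ Answers c e v
  · obtain ⟨hex, hans⟩ := hex
    -- A move that decreases the least rank makes progress for every admissible `k` at once.
    obtain ⟨k, hk, hmin⟩ : ∃ k,
        ForcesAnswer A c {x | x ∈ X ∧ ρ x < ρ v} {x | x ∈ X ∧ ρ x = ρ v} e k v ∧
        ∀ m, ForcesAnswer A c {x | x ∈ X ∧ ρ x < ρ v} {x | x ∈ X ∧ ρ x = ρ v} e m v → k ≤ m :=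
      ⟨Nat.find hex, Nat.find_spec hex, fun m hm => Nat.find_min' hex hm⟩
    cases k with
    | zero => exact absurd hk hans
    | succ k =>
      rcases hk with hk | ⟨hk, -⟩
      · exact absurd hk hans
      obtain ⟨u, hu, hu'⟩ := hk hv.1
      have := mem_and_le_of_mem_layers (hu'.imp_right And.left)
      refine ⟨u, hu, fun _ _ => ⟨this.1, this.2, fun m hm _ => ⟨k, hmin m hm, fun heq => ?_⟩⟩⟩
      rcases hu' with h | h
      · exact absurd heq h.2.ne
      · exact h.2
  · obtain ⟨N, hN⟩ := hlay v hv.2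
    obtain ⟨u, hu, hu'⟩ := (hN v ⟨hv.2, rfl⟩).1.1 hv.1
    have := mem_and_le_of_mem_layers hu'
    exact ⟨u, hu, fun _ _ => ⟨this.1, this.2, fun k hk ha => absurd ⟨⟨k, hk⟩, ha⟩ hex⟩⟩

theorem isProgress_of_notMem_eve
    (hlay : ∀ v ∈ X, IsLayer A c {u | u ∈ X ∧ ρ u < ρ v} {u | u ∈ X ∧ ρ u = ρ v})
    {v u : V} (e : ℕ) (hv : v ∉ A.eve) (hX : v ∈ X) (hu : A.Edge v u) :
    IsProgress A c X ρ e v u := by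
  obtain ⟨N, hN⟩ := hlay v hX
  have := mem_and_le_of_mem_layers ((hN v ⟨hX, rfl⟩).1.2 hv u hu)
  refine ⟨this.1, this.2, fun k hk hans => ?_⟩
  cases k with
  | zero => exact absurd hk hans
  | succ k =>
    rcases hk with hk | ⟨-, hk⟩
    · exact absurd hk hans
    refine ⟨k, Nat.lt_succ_self k, fun heq => ?_⟩
    rcases hk hv u hu with h | h
    · exact absurd heq h.2.ne
    · exact h.2

/-- A play in a layered set is winning for the finitary parity condition if all its moves make
progress for the smallest request that was opened since the layer was last changed. -/
theorem mem_finParity_of_isProgress {d : ℕ} {c : V → Fin (d + 1)}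
    (hlay : ∀ v ∈ X, IsLayer A (fun v => (c v : ℕ)) {u | u ∈ X ∧ ρ u < ρ v}
      {u | u ∈ X ∧ ρ u = ρ v})
    {π : ℕ → V} {e : ℕ → ℕ} (h0 : π 0 ∈ X) (he0 : e 0 = openRequest d (d + 1) (c (π 0)))
    (he : ∀ n, e (n + 1) =
      openRequest d (if ρ (π (n + 1)) = ρ (π n) then e n else d + 1) (c (π (n + 1))))
    (he_le : ∀ n, Odd (c (π n) : ℕ) → e n ≤ c (π n))
    (he_ans : ∀ n, e n ≤ d → ¬ Answers (fun v => (c v : ℕ)) (e n) (π n))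
    (hπ : ∀ n, π n ∈ X → IsProgress A (fun v => (c v : ℕ)) X ρ (e n) (π n) (π (n + 1))) :
    π ∈ FinParity c := by
  have hmem : ∀ n, π n ∈ X := by
    intro n
    induction n with
    | zero => exact h0
    | succ n ih => exact (hπ n ih).1
  have hanti : Antitone fun n => ρ (π n) := antitone_nat_of_succ_le fun n => (hπ n (hmem n)).2.1
  let F : Ordinal.{u} → ℕ → ℕ → V → Prop := fun α i k v =>
    ForcesAnswer A (fun v => (c v : ℕ)) {x | x ∈ X ∧ ρ x < α} {x | x ∈ X ∧ ρ x = α} i k v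
  have hbound : ∀ α, ∃ N, ∀ v ∈ X, ρ v = α → Odd (c v : ℕ) → ∃ k ≤ N, F α (c v) k v := by
    intro α
    by_cases h : ∃ v ∈ X, ρ v = α
    · obtain ⟨v, hv, rfl⟩ := h
      obtain ⟨N, hN⟩ := hlay v hv
      exact ⟨N, fun u hu huv => (hN u ⟨hu, huv⟩).2⟩
    · exact ⟨0, fun v hv hα => absurd ⟨v, hv, hα⟩ h⟩
  choose N hN using hbound
  have hfresh : ∀ v ∈ X, openRequest d (d + 1) (c v) ≤ d →
      ∃ k ≤ N (ρ v), F (ρ v) (openRequest d (d + 1) (c v)) k v := by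
    intro v hv hle
    have hc : (c v : ℕ) ≤ d + 1 := (c v).isLt.le
    by_cases hev : Even (c v : ℕ)
    · simp [openRequest, hev, hc] at hle
    · rw [show openRequest d (d + 1) (c v) = c v by simp [openRequest, hev, hc]]
      exact hN _ v hv rfl (Nat.not_even_iff_odd.1 hev)
  -- The open request was made in the current layer: either the present vertex has just made it and
  -- the layer's bound applies, or it persists and the last move lowered its rank.
  have hinv : ∀ n, e n ≤ d → ∃ k ≤ N (ρ (π n)), F (ρ (π n)) (e n) k (π n) := by
    intro n
    induction n with
    | zero => rw [he0]; exact hfresh _ h0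
    | succ n ih =>
      intro hle
      by_cases hρ : ρ (π (n + 1)) = ρ (π n)
      · have hen := he n
        rw [if_pos hρ] at hen
        by_cases hodd : Odd (c (π (n + 1)) : ℕ) ∧ e (n + 1) = c (π (n + 1))
        · rw [hodd.2]
          exact hN _ _ (hmem _) rfl hodd.1
        · have heq : e (n + 1) = e n := by
            unfold openRequest at hen
            split_ifs at hen with h1 h2
            · omega
            · exact hen
            · have h3 := Nat.not_even_iff_odd.1 h1
              rcases min_choice (e n) (c (π (n + 1)) : ℕ) with h | h
              · rwa [h] at hen
              · exact absurd ⟨h3, hen.trans h⟩ hodd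
          rw [heq] at hle ⊢
          obtain ⟨k, hk, hF⟩ := ih hle
          obtain ⟨k', hk', hF'⟩ := (hπ n (hmem n)).2.2 k hF (he_ans n hle)
          rw [hρ]
          exact ⟨k', by omega, hF' hρ⟩
      · have hen := he n
        rw [if_neg hρ] at hen
        rw [hen] at hle ⊢
        exact hfresh _ (hmem _) hle
  -- A non-increasing sequence of ordinals is constant once it attains its minimum.
  obtain ⟨_, ⟨K, rfl⟩, hK⟩ := (wellFounded_lt (α := Ordinal.{u})).has_min
    (Set.range fun n => ρ (π n)) ⟨_, 0, rfl⟩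
  have hconst : ∀ n ≥ K, ρ (π n) = ρ (π K) := fun n hn =>
    le_antisymm (hanti hn) (not_lt.1 (hK _ ⟨n, rfl⟩))
  have hans := exists_answer_of_progress (d := d) (N := N (ρ (π K))) (K := K)
    (f := fun n => (c (π n) : ℕ)) (e := e) (F := fun i k n => F (ρ (π K)) i k (π n))
    (fun n hn hle => by simpa only [hconst n hn] using hinv n hle)
    (fun n hn k hle hF => by
      have h1 := hconst n hn
      have h2 : ρ (π (n + 1)) = ρ (π n) := by rw [h1, hconst (n + 1) (by omega)]
      refine ⟨by rw [he n, if_pos h2], ?_⟩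
      have hp := (hπ n (hmem n)).2.2 k
      rw [h1] at hp
      obtain ⟨k', hk', hF'⟩ := hp hF (he_ans n hle)
      exact ⟨k', hk', hF' (h2.trans h1)⟩)
  refine mem_finParity_iff.2 ⟨(d + 1) * N (ρ (π K)), Filter.eventually_atTop.2 ⟨K, fun n hn => ?_⟩⟩
  by_cases hev : Even (c (π n) : ℕ)
  · exact distParity_le (j := 0) (Nat.zero_le _) ⟨hev, le_rfl⟩
  · have hle := he_le n (Nat.not_even_iff_odd.1 hev)
    have hd : (c (π n) : ℕ) ≤ d := Nat.lt_succ_iff.1 (c (π n)).isLt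
    obtain ⟨j, hj, h1, h2⟩ := hans (e n) n hn rfl (hle.trans hd)
    exact distParity_le (hj.trans (Nat.mul_le_mul_right _ (by omega))) ⟨h1, h2.trans hle⟩

end Strategy

theorem edge_next {A : Arena V} (σ : EveStrategy A) (τ : AdamStrategy A) (w : List V) (v : V) :
    A.Edge v (next σ τ w v) := by
  unfold next
  split_ifs with h
  · exact σ.legal w ⟨v, h⟩
  · exact τ.legal w ⟨v, h⟩

/-- Eve has a strategy that wins from her whole winning set, and whose moves depend on the current
vertex and the smallest request that is open there. -/
theorem exists_strategy_openRequest (A : Arena V) {d : ℕ} (c : V → Fin (d + 1)) :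
    ∃ (𝓜 : MemoryStructure V (requestStates d)) (ν : V → ℕ → V) (σ : EveStrategy A),
      (∀ w v, σ.move w v = ν v (openRequest d (𝓜.state w v) (c v))) ∧
      EveStrategy.WinsFrom σ (FinParity c) (eveWinningSet A (FinParity c)) := by
  classical
  obtain ⟨X, ρ, hlay, hmax⟩ := exists_maximal_layering (IsLayer A fun v => (c v : ℕ))
  choose ν hν hν' using exists_isProgress hlay
  have hc : ∀ v, (c v : ℕ) ≤ d := fun v => Nat.lt_succ_iff.1 (c v).isLt
  -- The state omits the current vertex's colour, which `σ` adds itself. Requests are forgotten when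
  -- the layer changes; this happens only finitely often, so the limsup condition is unaffected.
  let 𝓜 : MemoryStructure V (requestStates d) :=
    { init := ⟨d + 1, mem_requestStates.2 (Or.inl rfl)⟩
      update := fun m u v => if ρ v = ρ u then ⟨openRequest d m (c u), openRequest_mem m.2 (hc u)⟩
        else ⟨d + 1, mem_requestStates.2 (Or.inl rfl)⟩ }
  let σ : EveStrategy A :=
    { move := fun w v => ν v (openRequest d (𝓜.state w v) (c v))
      legal := fun w v => hν v _ }
  refine ⟨𝓜, ν, σ, fun _ _ => rfl, fun v₀ hv₀ τ => ?_⟩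
  let m : ℕ → ℕ := fun n => 𝓜.state (position v₀ σ τ n).1 (position v₀ σ τ n).2
  have hm : ∀ n, m (n + 1) = if ρ (play v₀ σ τ (n + 1)) = ρ (play v₀ σ τ n) then
      openRequest d (m n) (c (play v₀ σ τ n)) else d + 1 := by
    intro n
    have : m (n + 1) = (𝓜.update (𝓜.state (position v₀ σ τ n).1 (position v₀ σ τ n).2)
      (play v₀ σ τ n) (play v₀ σ τ (n + 1)) : requestStates d) := rfl
    rw [this]
    simp only [𝓜]
    split_ifs <;> rfl
  refine mem_finParity_of_isProgress hlay (π := play v₀ σ τ)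
    (e := fun n => openRequest d (m n) (c (play v₀ σ τ n))) (eveWinningSet_subset hmax hv₀) rfl
    (fun n => by rw [hm]) (fun n hodd => ?_) (fun n hle => not_answered_of_openRequest_le hle)
    fun n hX => ?_
  · simp only [openRequest, Nat.not_even_iff_odd.2 hodd, if_false]
    exact min_le_right _ _
  · by_cases hv : play v₀ σ τ n ∈ A.eve
    · have : play v₀ σ τ (n + 1) =
          ν (play v₀ σ τ n) (openRequest d (m n) (c (play v₀ σ τ n))) := by
        have : play v₀ σ τ (n + 1) = next σ τ (position v₀ σ τ n).1 (play v₀ σ τ n) := rfl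
        rw [this, next, dif_pos hv]
        rfl
      rw [this]
      exact hν' _ _ hv hX
    · exact isProgress_of_notMem_eve hlay _ hv hX (edge_next σ τ _ _)

end FinitaryGames

theorem mainTheorem1 {V : Type*} [Countable V] (A : FinitaryGames.Arena V) :
    (∀ F : Set V, ∃ σ : FinitaryGames.EveStrategy A,
      FinitaryGames.EveStrategy.Memoryless σ ∧
      FinitaryGames.EveStrategy.WinsFrom σ (FinitaryGames.FinBuchi F)
        (FinitaryGames.eveWinningSet A (FinitaryGames.FinBuchi F))) ∧
    (∀ (d : ℕ) (c : V → Fin (d + 1)),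
      ∃ (M : Type) (_ : Finite M) (𝓜 : FinitaryGames.MemoryStructure V M)
        (σ : FinitaryGames.EveStrategy A),
        Nat.card M ≤ FinitaryGames.numOddColours d + 1 ∧
        FinitaryGames.EveStrategy.Uses σ 𝓜 ∧
        FinitaryGames.EveStrategy.WinsFrom σ (FinitaryGames.FinParity c)
          (FinitaryGames.eveWinningSet A (FinitaryGames.FinParity c))) := by
  constructor
  · intro F
    rw [FinitaryGames.finBuchi_eq_finParity]
    -- Only the number of colours matters from here on.
    generalize (fun v => _ : V → Fin (1 + 1)) = c
    obtain ⟨𝓜, ν, σ, hσ, hwin⟩ := FinitaryGames.exists_strategy_openRequest A c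
    refine ⟨σ, ⟨fun v => ν v (if (c v : ℕ) = 0 then 2 else 1), fun w v => ?_⟩, hwin⟩
    rw [hσ, FinitaryGames.openRequest_one (𝓜.state w v).2 (Nat.lt_succ_iff.1 (Fin.isLt _))]
  · intro d c
    obtain ⟨𝓜, ν, σ, hσ, hwin⟩ := FinitaryGames.exists_strategy_openRequest A c
    refine ⟨FinitaryGames.requestStates d, inferInstance, 𝓜, σ, ?_,
      ⟨fun v m => ν v (FinitaryGames.openRequest d m (c v)), hσ⟩, hwin⟩
    rw [Nat.card_eq_fintype_card, Fintype.card_coe]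
    exact FinitaryGames.card_requestStates_le d
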